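/- Notation. Let $1<p<\infty$ and let $X^p=X^p(\mathbb R_+)$ be the Banach space of (classes of a.e. equal) measurable functions $f:(0,\infty)\to\mathbb C$ with $\|f\|_{X^p}=\big(\int_0^\infty |f(x)|^p\,\frac{dx}{x}\big)^{1/p}<\infty$. For $t\in\mathbb R$ let $U(t)f(x)=f(e^tx)$; this is a group of isometries of $X^p$. Let $\Theta=x\frac{d}{dx}$ be its infinitesimal generator, $\Theta f=\frac{d}{dt}U(t)f\big|_{t=0}$ (derivative in the norm of $X^p$), let $\mathcal D^k(\Theta)$ be the domain of the $k$-th power $\Theta^k$, and for $\sigma>0$ let $$\mathbf B_\sigma^p(\Theta)=\Big\{f\in\bigcap_k\mathcal D^k(\Theta):\ \|\Theta^kf\|_{X^p}\le\sigma^k\|f\|_{X^p}\text{ for all }k\in\mathbb N\Big\}.$$ For $m\ge1$, $k\in\mathbb Z$ put $$A_{m,k}=\frac{(2m-1)!}{\pi(k-\frac12)^{2m}}\sum_{j=0}^{m-1}\frac{(-1)^j}{(2j)!}\big(\pi(k-\tfrac12)\big)^{2j},\qquad B_{m,0}=(-1)^{m+1}\frac{\pi^{2m}}{2m+1},$$ $$B_{m,k}=\frac{(2m)!}{\pi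 k^{2m+1}}\sum_{j=0}^{m-1}\frac{(-1)^j(\pi k)^{2j+1}}{(2j+1)!}\quad(k\neq0),$$ and define the Riesz–Boas operators on $X^p$ by $$\mathcal R^{(2m-1)}(\sigma)f(x)=\Big(\frac\sigma\pi\Big)^{2m-1}\sum_{k\in\mathbb Z}(-1)^{k+1}A_{m,k}\,f\big(e^{\frac\pi\sigma(k-\frac12)}x\big),\qquad \mathcal R^{(2m)}(\sigma)f(x)=\Big(\frac\sigma\pi\Big)^{2m}\sum_{k\in\mathbb Z}(-1)^{k+1}B_{m,k}\,f\big(e^{\frac{\pi k}\sigma}x\big),$$ the series being taken in $X^p$. Write $\mathcal R(\sigma)=\mathcal R^{(1)}(\sigma)$ and $\mathcal R^r(\sigma)=\mathcal R(\sigma)\circ\cdots\circ\mathcal R(\sigma)$ ($r$ factors). Statement. Let $1<p<\infty$ and $\sigma>0$. The series defining $\mathcal R^{(r)}(\sigma)g$ converges unconditionally in $X^p$ for every $g\in X^p$ and every integer $r\ge1$. The operator $\mathcal R(\sigma)$ maps $\mathbf B_\sigma^p(\Theta)$ into itself and commutes with $\Theta$ there: $\Theta\,\mathcal R(\sigma)f=\mathcal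 R(\sigma)\,\Theta f$ for $f\in\mathbf B_\sigma^p(\Theta)$. Moreover, for every $f\in\mathbf B_\sigma^p(\Theta)$ and every integer $r\ge1$, $$\Theta^rf=\mathcal R^{(r)}(\sigma)f=\mathcal R^r(\sigma)f .$$ -/

import Mathlib

open MeasureTheory Set Filter Topology
open scoped ENNReal Nat

noncomputable section

namespace Mellin

/-- The measure `dx / x` on `ℝ₊ = (0, ∞)`. -/
def haar : Measure ℝ :=
  (volume.restrict (Ioi 0)).withDensity (fun x => ENNReal.ofReal x⁻¹)

/-- The space `X^p(ℝ₊)`: (classes of a.e. equal) measurable functions `f` on `ℝ₊` such that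
`x ↦ f x * x ^ (-1/p)` is in `L^p(ℝ₊, dx)`, i.e. such that `f` is in `L^p(ℝ₊, dx/x)`;
see `eLpNorm_haar`. -/
abbrev X (p : ℝ≥0∞) : Type := Lp ℂ p haar

/-- The `L^p(dx/x)`-norm of `f` is the norm `‖f(·)(·)^{-1/p}‖_{L^p(ℝ₊, dx)}`. -/
theorem eLpNorm_haar (p : ℝ≥0∞) (h0 : p ≠ 0) (hp : p ≠ ∞) (f : ℝ → ℂ) :
    eLpNorm f p haar =
      eLpNorm (fun x => f x * ((x ^ (-1 / p.toReal) : ℝ) : ℂ)) p (volume.restrict (Ioi 0)) := by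
  have hpos : 0 < p.toReal := ENNReal.toReal_pos h0 hp
  rw [eLpNorm_eq_lintegral_rpow_enorm_toReal h0 hp, eLpNorm_eq_lintegral_rpow_enorm_toReal h0 hp]
  congr 1
  rw [haar, lintegral_withDensity_eq_lintegral_mul_non_measurable _ (by fun_prop)
    (ae_of_all _ fun x => ENNReal.ofReal_lt_top)]
  refine setLIntegral_congr_fun measurableSet_Ioi fun x hx => ?_
  have hx0 : (0 : ℝ) < x := hx
  have h1 : ‖((x ^ (-1 / p.toReal) : ℝ) : ℂ)‖ₑ = ENNReal.ofReal (x ^ (-1 / p.toReal)) := by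
    rw [← ofReal_norm, Complex.norm_real, Real.norm_of_nonneg (by positivity)]
  simp only [Pi.mul_apply, enorm_mul, h1]
  rw [ENNReal.mul_rpow_of_nonneg _ _ hpos.le,
    ENNReal.ofReal_rpow_of_nonneg (by positivity) hpos.le, ← Real.rpow_mul hx0.le,
    div_mul_cancel₀ _ hpos.ne', Real.rpow_neg_one, mul_comm]

/-- Dilations preserve `dx / x`. -/
theorem measurePreserving_dilation (t : ℝ) :
    MeasurePreserving (fun x : ℝ => Real.exp t * x) haar haar := by
  have hm : Measurable (fun x : ℝ => Real.exp t * x) := by fun_prop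
  refine ⟨hm, Measure.ext fun s hs => ?_⟩
  have hc : 0 < Real.exp t := Real.exp_pos t
  set G : ℝ → ℝ≥0∞ := (s ∩ Ioi 0).indicator (fun x => ENNReal.ofReal x⁻¹) with hG
  have hGm : Measurable G :=
    Measurable.indicator (by fun_prop) (hs.inter measurableSet_Ioi)
  have e1 : ∀ u : Set ℝ, MeasurableSet u →
      haar u = ∫⁻ x, (u ∩ Ioi 0).indicator (fun x => ENNReal.ofReal x⁻¹) x := by
    intro u hu
    rw [haar, withDensity_apply _ hu, Measure.restrict_restrict hu,
      lintegral_indicator (hu.inter measurableSet_Ioi)]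
  rw [Measure.map_apply hm hs, e1 _ (hm hs), e1 _ hs]
  have e2 : ∀ x : ℝ, (((fun x : ℝ => Real.exp t * x) ⁻¹' s) ∩ Ioi 0).indicator
      (fun x => ENNReal.ofReal x⁻¹) x = ENNReal.ofReal (Real.exp t) * G (Real.exp t * x) := by
    intro x
    have hiff : x ∈ ((fun x : ℝ => Real.exp t * x) ⁻¹' s) ∩ Ioi 0 ↔
        Real.exp t * x ∈ s ∩ Ioi 0 := by
      simp [hc]
    by_cases hx : Real.exp t * x ∈ s ∩ Ioi 0
    · rw [indicator_of_mem (hiff.2 hx), hG, indicator_of_mem hx, ← ENNReal.ofReal_mul hc.le,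
        mul_inv, mul_inv_cancel_left₀ hc.ne']
    · rw [indicator_of_notMem (fun h => hx (hiff.1 h)), hG, indicator_of_notMem hx, mul_zero]
  simp_rw [e2]
  have e3 : ∫⁻ x, ENNReal.ofReal (Real.exp t) * G (Real.exp t * x) =
      ENNReal.ofReal (Real.exp t) * ∫⁻ x, G (Real.exp t * x) :=
    lintegral_const_mul _ (hGm.comp hm)
  have e4 : ∫⁻ x, G (Real.exp t * x) =
      ∫⁻ x, G x ∂(Measure.map (fun x : ℝ => Real.exp t * x) volume) :=
    (lintegral_map hGm hm).symm
  rw [e3, e4,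
    Real.map_volume_mul_left hc.ne', lintegral_smul_measure, smul_eq_mul, ← mul_assoc,
    ← ENNReal.ofReal_mul hc.le, abs_of_pos (inv_pos.2 hc), mul_inv_cancel₀ hc.ne',
    ENNReal.ofReal_one, one_mul]

variable (p : ℝ≥0∞) [Fact (1 ≤ p)]

/-- The group of Mellin translations, `U(t) f (x) = f (e^t x)`, on `X^p(ℝ₊)`. -/
def U (t : ℝ) : X p →ₗᵢ[ℂ] X p :=
  Lp.compMeasurePreservingₗᵢ ℂ (fun x : ℝ => Real.exp t * x) (measurePreserving_dilation t)

/-- The domain of the infinitesimal generator of the group `U`: all `f` for which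
`t ↦ U(t) f` is differentiable at `0`, with respect to the norm of `X^p(ℝ₊)`. -/
def InDomain (f : X p) : Prop := DifferentiableAt ℝ (fun t : ℝ => U p t f) 0

/-- The infinitesimal generator `Θ = x d/dx`, `Θ f = d/dt U(t) f |_{t = 0}`
(meaningful for `f` in its domain). -/
def Theta (f : X p) : X p := deriv (fun t : ℝ => U p t f) 0

/-- The domain `𝒟^k(Θ)` of the power `Θ^k`. -/
def powDomain : ℕ → Set (X p)
  | 0 => univ
  | k + 1 => {f | InDomain p f ∧ Theta p f ∈ powDomain k}

/-- The Bernstein space `B_σ^p(Θ)`. -/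
def Bernstein (σ : ℝ) : Set (X p) :=
  {f | (∀ k : ℕ, f ∈ powDomain p k) ∧ ∀ k : ℕ, ‖(Theta p)^[k] f‖ ≤ σ ^ k * ‖f‖}

/-- `A_{m,k} = (-1)^(k+1) sinc^(2m-1) (1/2 - k)`, for `m ≥ 1`. -/
def A (m : ℕ) (k : ℤ) : ℝ :=
  ((2 * m - 1)! : ℝ) / (Real.pi * ((k : ℝ) - 1 / 2) ^ (2 * m)) *
    ∑ j ∈ Finset.range m,
      (-1 : ℝ) ^ j / ((2 * j)! : ℝ) * (Real.pi * ((k : ℝ) - 1 / 2)) ^ (2 * j)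

/-- `B_{m,k} = (-1)^(k+1) sinc^(2m) (-k)`, for `m ≥ 1`. -/
def B (m : ℕ) (k : ℤ) : ℝ :=
  if k = 0 then (-1 : ℝ) ^ (m + 1) * (Real.pi ^ (2 * m) / (2 * (m : ℝ) + 1))
  else ((2 * m)! : ℝ) / (Real.pi * (k : ℝ) ^ (2 * m + 1)) *
    ∑ j ∈ Finset.range m,
      (-1 : ℝ) ^ j * (Real.pi * (k : ℝ)) ^ (2 * j + 1) / ((2 * j + 1)! : ℝ)

/-- The `k`-th term of the series defining the Riesz–Boas operator of order `r ≥ 1`: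
`r = 2m` in the first case and `r = 2m - 1` in the second. -/
def rieszBoasTerm (r : ℕ) (σ : ℝ) (f : X p) (k : ℤ) : X p :=
  if Even r then
    ((-1 : ℝ) ^ (k + 1) * B (r / 2) k) • U p (Real.pi * (k : ℝ) / σ) f
  else
    ((-1 : ℝ) ^ (k + 1) * A ((r + 1) / 2) k) • U p (Real.pi / σ * ((k : ℝ) - 1 / 2)) f

/-- The Riesz–Boas operator `ℛ^(r)(σ)` on `X^p(ℝ₊)`, `r ≥ 1`; the series is taken in the norm
of `X^p(ℝ₊)`. -/
def rieszBoas (r : ℕ) (σ : ℝ) (f : X p) : X p :=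
  (σ / Real.pi) ^ r • ∑' k : ℤ, rieszBoasTerm p r σ f k

end Mellin

end

/-!
Let `S z = sin (z + ε π / 2)` with `ε` of the parity of `r`, let `T` be the Taylor polynomial of `S`
at the origin of degree less than `r`, and let `G` be an entire function with
`‖G z‖ ≤ M exp |Im z|`. The coefficient of `z ^ r` in `S` vanishes, so `Q = (S - T) / z ^ (r + 1)`
is entire, and `T G / (z ^ (r + 1) S) = G / z ^ (r + 1) - Q G / S`. On circles that avoid the zeros
of `S` one has `exp |Im z| ≤ 6 |S z|`, so the left-hand side is `O(|z| ^ (-2))` and its residues add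
up to zero: this expresses the `r`-th derivative of `G` at the origin through the values of `G` at
the zeros of `S`, with the Riesz–Boas coefficients as weights.

For a vector `f` of the Bernstein space, the orbit `t ↦ U (t / σ) f` extends to such a function `G`,
which gives `Θ ^ r f = ℛ^(r)(σ) f`. When `r = 1` the absolute values of the weights sum to `π`, so
that `‖Θ g‖ ≤ σ ‖g‖` for every vector `g` whose orbit extends to an entire function of exponential
type `σ`. Hence `Θ = ℛ(σ)` preserves the Bernstein space, and can be iterated there.
-/

section Residue

variable {E : Type*} [NormedAddCommGroup E] [NormedSpace ℂ E]

/-- The residue `a` of a function with at most a simple pole at `ζ`, encoded by the limit of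
`(z - ζ) h(z)`; holomorphy of `h` in a punctured neighbourhood of `ζ` is assumed separately. -/
def HasSimpleResidueAt (h : ℂ → E) (a : E) (ζ : ℂ) : Prop :=
  Tendsto (fun z => (z - ζ) • h z) (𝓝[≠] ζ) (𝓝 a)

theorem HasSimpleResidueAt.sub {f g : ℂ → E} {a b : E} {ζ : ℂ} (hf : HasSimpleResidueAt f a ζ)
    (hg : HasSimpleResidueAt g b ζ) : HasSimpleResidueAt (fun z => f z - g z) (a - b) ζ := by
  simpa only [HasSimpleResidueAt, smul_sub] using Tendsto.sub hf hg

theorem HasSimpleResidueAt.sum {ι : Type*} {s : Finset ι} {f : ι → ℂ → E} {a : ι → E} {ζ : ℂ}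
    (hf : ∀ i ∈ s, HasSimpleResidueAt (f i) (a i) ζ) :
    HasSimpleResidueAt (fun z => ∑ i ∈ s, f i z) (∑ i ∈ s, a i) ζ := by
  simpa only [HasSimpleResidueAt, Finset.smul_sum] using tendsto_finsetSum s hf

theorem hasSimpleResidueAt_zero {f : ℂ → E} {ζ : ℂ} (hf : ContinuousAt f ζ) :
    HasSimpleResidueAt f 0 ζ := by
  have h : ContinuousAt (fun z => (z - ζ) • f z) ζ := by fun_prop
  simpa [HasSimpleResidueAt] using h.tendsto.mono_left nhdsWithin_le_nhds

theorem hasSimpleResidueAt_inv_smul (a : E) (ζ : ℂ) :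
    HasSimpleResidueAt (fun z => (z - ζ)⁻¹ • a) a ζ := by
  refine tendsto_const_nhds.congr' ?_
  filter_upwards [self_mem_nhdsWithin] with z hz
  rw [smul_inv_smul₀ (sub_ne_zero.2 hz)]

theorem differentiableAt_inv_sub_smul (a : E) {ζ z : ℂ} (hz : z ≠ ζ) :
    DifferentiableAt ℂ (fun w => (w - ζ)⁻¹ • a) z := by
  have : z - ζ ≠ 0 := sub_ne_zero.2 hz
  fun_prop (disch := assumption)

theorem hasSimpleResidueAt_sum_inv_smul {Z : Finset ℂ} (a : ℂ → E) {ζ : ℂ} (hζ : ζ ∈ Z) :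
    HasSimpleResidueAt (fun z => ∑ ξ ∈ Z, (z - ξ)⁻¹ • a ξ) (a ζ) ζ := by
  have hterm : ∀ ξ ∈ Z,
      HasSimpleResidueAt (fun z => (z - ξ)⁻¹ • a ξ) (if ξ = ζ then a ξ else 0) ζ := by
    intro ξ _
    split_ifs with h
    · exact h ▸ hasSimpleResidueAt_inv_smul (a ξ) ξ
    · exact hasSimpleResidueAt_zero (differentiableAt_inv_sub_smul _ (Ne.symm h)).continuousAt
  simpa [hζ] using HasSimpleResidueAt.sum hterm

theorem hasSimpleResidueAt_div_smul {q S : ℂ → ℂ} {G : ℂ → E} {ζ S' : ℂ}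
    (hq : ContinuousAt q ζ) (hS : HasDerivAt S S' ζ) (hS₀ : S ζ = 0) (hS' : S' ≠ 0)
    (hG : ContinuousAt G ζ) :
    HasSimpleResidueAt (fun z => (q z / S z) • G z) ((q ζ / S') • G ζ) ζ := by
  refine ((((hq.tendsto.mono_left nhdsWithin_le_nhds).div hS.tendsto_slope hS').smul
    (hG.tendsto.mono_left nhdsWithin_le_nhds))).congr fun z => ?_
  rw [Pi.div_apply, slope_def_field, hS₀, sub_zero, smul_smul, div_div_eq_mul_div, mul_div_assoc',
    mul_comm (q z)]

variable [CompleteSpace E]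

theorem HasSimpleResidueAt.differentiableAt_update_limUnder {h : ℂ → E} {ζ : ℂ}
    (hres : HasSimpleResidueAt h 0 ζ) (hd : ∀ᶠ z in 𝓝[≠] ζ, DifferentiableAt ℂ h z) :
    DifferentiableAt ℂ (Function.update h ζ (limUnder (𝓝[≠] ζ) h)) ζ := by
  obtain ⟨s, hs, hds⟩ := eventually_iff_exists_mem.1 (eventually_nhdsWithin_iff.1 hd)
  have hsmall : (fun z => h z - h ζ) =o[𝓝[≠] ζ] fun z => (z - ζ)⁻¹ := by
    have hlim : Tendsto (fun z => (z - ζ) • (h z - h ζ)) (𝓝[≠] ζ) (𝓝 0) := by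
      simpa [HasSimpleResidueAt] using
        hres.sub (hasSimpleResidueAt_zero (continuousAt_const (y := h ζ)))
    have hmul := (Asymptotics.isBigO_refl (fun z : ℂ => (z - ζ)⁻¹) (𝓝[≠] ζ)).smul_isLittleO
      ((Asymptotics.isLittleO_one_iff ℂ).2 hlim)
    refine hmul.congr' ?_ (.of_forall fun z => by simp)
    filter_upwards [self_mem_nhdsWithin] with z hz
    rw [inv_smul_smul₀ (sub_ne_zero.2 hz)]
  exact (Complex.differentiableOn_update_limUnder_of_isLittleO hs
    (fun z hz => (hds z hz.1 hz.2).differentiableWithinAt) hsmall).differentiableAt hs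

theorem exists_differentiableAt_eq_off_finset {h : ℂ → E} {s : Set ℂ} {Z : Finset ℂ}
    (hZ : ∀ ζ ∈ Z, s ∈ 𝓝 ζ) (hd : ∀ z ∈ s, z ∉ Z → DifferentiableAt ℂ h z)
    (hres : ∀ ζ ∈ Z, HasSimpleResidueAt h 0 ζ) :
    ∃ K : ℂ → E, (∀ z ∈ s, DifferentiableAt ℂ K z) ∧ ∀ z ∉ Z, K z = h z := by
  classical
  let K : ℂ → E := fun z => if z ∈ Z then limUnder (𝓝[≠] z) h else h z
  have hK : ∀ z ∉ Z, K z = h z := fun z hz => if_neg hz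
  have hnhds : ∀ z, ∀ᶠ w in 𝓝[≠] z, w ∉ Z := fun z =>
    nhdsNE_le_cofinite z Z.finite_toSet.compl_mem_cofinite
  refine ⟨K, fun z hz => ?_, hK⟩
  by_cases hzZ : z ∈ Z
  · have hdz : ∀ᶠ w in 𝓝[≠] z, DifferentiableAt ℂ h w := by
      filter_upwards [hnhds z, nhdsWithin_le_nhds (hZ z hzZ)] with w hwZ hw using hd w hw hwZ
    refine ((hres z hzZ).differentiableAt_update_limUnder hdz).congr_of_eventuallyEq ?_
    refine eventuallyEq_nhds_of_eventuallyEq_nhdsNE ?_ (by simp [K, hzZ])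
    filter_upwards [hnhds z, self_mem_nhdsWithin] with w hwZ hw
    rw [hK w hwZ, Function.update_of_ne hw]
  · refine (hd z hz hzZ).congr_of_eventuallyEq ?_
    filter_upwards [Z.finite_toSet.isClosed.isOpen_compl.mem_nhds hzZ] with w hw using hK w hw

theorem circleIntegral_eq_sum_of_hasSimpleResidueAt {h : ℂ → E} {c : ℂ} {R : ℝ} (hR : 0 ≤ R)
    {Z : Finset ℂ} {a : ℂ → E} (hZ : ↑Z ⊆ Metric.ball c R)
    (hd : ∀ z ∈ Metric.closedBall c R, z ∉ Z → DifferentiableAt ℂ h z)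
    (hres : ∀ ζ ∈ Z, HasSimpleResidueAt h (a ζ) ζ) :
    (∮ z in C(c, R), h z) = (2 * Real.pi * Complex.I) • ∑ ζ ∈ Z, a ζ := by
  have hsphere : ∀ z ∈ Metric.sphere c R, ∀ ζ ∈ Z, z ≠ ζ := by
    rintro z hz ζ hζ rfl
    exact (Metric.mem_ball.1 (hZ hζ)).ne (Metric.mem_sphere.1 hz)
  obtain ⟨K, hK, hKeq⟩ := exists_differentiableAt_eq_off_finset (s := Metric.closedBall c R)
    (h := fun z => h z - ∑ ζ ∈ Z, (z - ζ)⁻¹ • a ζ)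
    (fun ζ hζ => Metric.closedBall_mem_nhds_of_mem (hZ hζ))
    (fun z hz hzZ => (hd z hz hzZ).fun_sub (.fun_sum fun ζ hζ =>
      differentiableAt_inv_sub_smul _ fun h => hzZ (h ▸ hζ)))
    (fun ζ hζ => by simpa using (hres ζ hζ).sub (hasSimpleResidueAt_sum_inv_smul a hζ))
  have hKint : (∮ z in C(c, R), K z) = 0 :=
    DiffContOnCl.circleIntegral_eq_zero hR
      (DifferentiableOn.diffContOnCl_ball (fun z hz => (hK z hz).differentiableWithinAt) subset_rfl)
  have hterm : ∀ ζ ∈ Z, CircleIntegrable (fun z => (z - ζ)⁻¹ • a ζ) c R := fun ζ hζ =>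
    ContinuousOn.circleIntegrable hR fun z hz =>
      (differentiableAt_inv_sub_smul _ (hsphere z hz ζ hζ)).continuousAt.continuousWithinAt
  have hint : CircleIntegrable h c R := ContinuousOn.circleIntegrable hR fun z hz =>
    (hd z (Metric.sphere_subset_closedBall hz)
      fun hzZ => hsphere z hz z hzZ rfl).continuousAt.continuousWithinAt
  rw [circleIntegral.integral_congr hR fun z hz => hKeq z fun hzZ => hsphere z hz z hzZ rfl,
    circleIntegral.integral_sub hint (.fun_sum _ hterm), circleIntegral.integral_fun_sum hterm,
    sub_eq_zero] at hKint
  rw [hKint, Finset.smul_sum]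
  refine Finset.sum_congr rfl fun ζ hζ => ?_
  rw [circleIntegral.integral_smul_const, circleIntegral.integral_sub_inv_of_mem_ball (hZ hζ)]

end Residue

open scoped Real

section SineTaylor

variable {𝕜 : Type*} [RCLike 𝕜]

/-- The Taylor polynomial of degree less than `n` of `z ↦ sin (z + θ)` at the origin, as a function
on `ℝ` or `ℂ`. -/
noncomputable def sinTaylor (θ : ℝ) (n : ℕ) (z : 𝕜) : 𝕜 :=
  ∑ j ∈ Finset.range n, (Real.sin (θ + j * (π / 2)) / j ! : ℝ) • z ^ j

theorem sinTaylor_succ (θ : ℝ) (n : ℕ) (z : 𝕜) :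
    sinTaylor θ (n + 1) z =
      sinTaylor θ n z + (Real.sin (θ + n * (π / 2)) / n ! : ℝ) • z ^ n :=
  Finset.sum_range_succ _ _

theorem ofReal_sinTaylor (θ : ℝ) (n : ℕ) (x : ℝ) :
    ((sinTaylor θ n x : ℝ) : ℂ) = sinTaylor θ n (x : ℂ) := by
  simp [sinTaylor]

theorem differentiable_sinTaylor (θ : ℝ) (n : ℕ) : Differentiable ℂ (sinTaylor θ n : ℂ → ℂ) := by
  unfold sinTaylor
  fun_prop

theorem norm_sinTaylor_div_pow_le (θ : ℝ) (n : ℕ) {z : 𝕜} (hz : 1 ≤ ‖z‖) :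
    ‖sinTaylor θ n z / z ^ (n + 1)‖ ≤ n / ‖z‖ ^ 2 := by
  have hterm : ∀ j ∈ Finset.range n,
      ‖(Real.sin (θ + j * (π / 2)) / j ! : ℝ) • z ^ j‖ ≤ ‖z‖ ^ (n - 1) := by
    intro j hj
    rw [norm_smul, norm_div, Real.norm_natCast, norm_pow]
    have hcoeff : ‖Real.sin (θ + j * (π / 2))‖ / j ! ≤ 1 :=
      div_le_one_of_le₀ ((Real.abs_sin_le_one _).trans (mod_cast j.factorial_pos)) (by positivity)
    exact (mul_le_of_le_one_left (by positivity) hcoeff).trans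
      (pow_le_pow_right₀ hz (Nat.le_sub_one_of_lt (Finset.mem_range.1 hj)))
  have hsum : ‖sinTaylor θ n z‖ ≤ n * ‖z‖ ^ (n - 1) := by
    simpa [sinTaylor] using norm_sum_le_of_le _ hterm
  rw [norm_div, norm_pow, div_le_div_iff₀ (by positivity) (by positivity)]
  rcases n with _ | n
  · simp [sinTaylor]
  · calc ‖sinTaylor θ (n + 1) z‖ * ‖z‖ ^ 2
        ≤ (n + 1 : ℕ) * ‖z‖ ^ n * ‖z‖ ^ 2 := mul_le_mul_of_nonneg_right hsum (by positivity)
      _ = (n + 1 : ℕ) * ‖z‖ ^ (n + 1 + 1) := by ring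

theorem sinTaylor_eq_exp_partial_sums (θ : ℝ) (n : ℕ) (z : ℂ) :
    sinTaylor θ n z =
      (Complex.exp (-θ * Complex.I) * ∑ j ∈ Finset.range n, (-z * Complex.I) ^ j / (j ! : ℂ) -
        Complex.exp (θ * Complex.I) * ∑ j ∈ Finset.range n, (z * Complex.I) ^ j / (j ! : ℂ)) *
          Complex.I / 2 := by
  rw [sinTaylor, Finset.mul_sum, Finset.mul_sum, ← Finset.sum_sub_distrib, Finset.sum_mul,
    Finset.sum_div]
  refine Finset.sum_congr rfl fun j _ => ?_
  have hpos : Complex.exp ((θ + j * (π / 2)) * Complex.I) =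
      Complex.exp (θ * Complex.I) * Complex.I ^ j := by
    rw [add_mul, Complex.exp_add, mul_assoc (j : ℂ), Complex.exp_nat_mul,
      Complex.exp_pi_div_two_mul_I]
  have hneg : Complex.exp (-(θ + j * (π / 2)) * Complex.I) =
      Complex.exp (-θ * Complex.I) * (-Complex.I) ^ j := by
    rw [show -(θ + j * (π / 2)) * Complex.I = -θ * Complex.I + j * (-π / 2 * Complex.I) by ring,
      Complex.exp_add, Complex.exp_nat_mul, Complex.exp_neg_pi_div_two_mul_I]
  rw [Complex.real_smul]
  push_cast
  rw [Complex.sin, hpos, hneg, mul_pow, neg_mul, ← mul_neg, mul_pow]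
  ring

theorem norm_sin_add_sub_sinTaylor_le (θ : ℝ) (n : ℕ) (z : ℂ) :
    ‖Complex.sin (z + θ) - sinTaylor θ n z‖ ≤ ‖z‖ ^ n * Real.exp ‖z‖ := by
  have hpos := Complex.norm_exp_sub_sum_le_norm_mul_exp (z * Complex.I) n
  have hneg := Complex.norm_exp_sub_sum_le_norm_mul_exp (-z * Complex.I) n
  have hsplit : Complex.sin (z + θ) =
      (Complex.exp (-θ * Complex.I) * Complex.exp (-z * Complex.I) -
        Complex.exp (θ * Complex.I) * Complex.exp (z * Complex.I)) * Complex.I / 2 := by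
    rw [Complex.sin, ← Complex.exp_add, ← Complex.exp_add]
    ring_nf
  rw [hsplit, sinTaylor_eq_exp_partial_sums, ← sub_div, ← sub_mul, sub_sub_sub_comm, ← mul_sub,
    ← mul_sub, norm_div, norm_mul, Complex.norm_I, mul_one, Complex.norm_ofNat,
    div_le_iff₀ two_pos]
  refine (norm_sub_le _ _).trans ?_
  rw [norm_mul, norm_mul, Complex.norm_exp_ofReal_mul_I, ← Complex.ofReal_neg,
    Complex.norm_exp_ofReal_mul_I]
  simp only [norm_mul, norm_neg, Complex.norm_I, mul_one] at hpos hneg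
  linarith

end SineTaylor

section Kernel

theorem norm_sin_sq (z : ℂ) :
    ‖Complex.sin z‖ ^ 2 = Real.sin z.re ^ 2 + Real.sinh z.im ^ 2 := by
  have hsin : Complex.sin z =
      ⟨Real.sin z.re * Real.cosh z.im, Real.cos z.re * Real.sinh z.im⟩ := by
    rw [Complex.sin_eq, Complex.mk_eq_add_mul_I]
    push_cast
    ring
  rw [hsin, Complex.sq_norm, Complex.normSq_mk]
  linear_combination (Real.sin z.re ^ 2) * Real.cosh_sq z.im +
    Real.sinh z.im ^ 2 * Real.sin_sq_add_cos_sq z.re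

theorem half_le_cos_sub_abs {x y R : ℝ} (hR : 3 / 2 ≤ R) (hxy : x ^ 2 + y ^ 2 = R ^ 2)
    (hy : |y| ≤ 1) : 1 / 2 ≤ Real.cos (R - |x|) := by
  have hy2 : y ^ 2 ≤ 1 := (sq_le_one_iff_abs_le_one y).2 hy
  have hxR : |x| ≤ R := abs_le_of_sq_le_sq (by nlinarith) (by linarith)
  have hsub : R - |x| ≤ 1 := by nlinarith [sq_abs x, abs_nonneg x]
  nlinarith [Real.one_sub_sq_div_two_le_cos (x := R - |x|)]

theorem exp_abs_le_of_sq_eq_add_sinh_sq {y s w : ℝ} (hw : 0 ≤ w)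
    (hsq : w ^ 2 = s ^ 2 + Real.sinh y ^ 2) (hs : |y| ≤ 1 → 1 / 2 ≤ |s|) :
    Real.exp |y| ≤ 6 * w := by
  rcases le_total 1 |y| with hy | hy
  · have hsinh : Real.sinh |y| ≤ w := by
      refine le_of_sq_le_sq ?_ hw
      rw [hsq, ← Real.abs_sinh, sq_abs]
      exact le_add_of_nonneg_left (sq_nonneg s)
    rw [Real.sinh_eq] at hsinh
    linarith [Real.exp_le_one_iff.2 (neg_nonpos.2 (abs_nonneg y)), Real.add_one_le_exp |y|]
  · have hsw : |s| ≤ w :=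
      abs_le_of_sq_le_sq (hsq ▸ le_add_of_nonneg_right (sq_nonneg (Real.sinh y))) hw
    linarith [hs hy, (Real.exp_le_exp.2 hy).trans Real.exp_one_lt_three.le]

/-- The phase for which `z ↦ sin (z + phase ε)` is `sin`, `cos`, `-sin`, … for `ε = 0, 1, 2, …`.
Only the parity of `ε` matters for the Riesz–Boas coefficients: `ε = 1` serves odd orders and
`ε = 0` even ones. -/
noncomputable def phase (ε : ℕ) : ℝ := ε * (π / 2)

/-- The zeros of `z ↦ sin (z + phase ε)`. -/
noncomputable def node (ε : ℕ) (k : ℤ) : ℝ := π * (k - ε / 2)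

/-- The radii of circles around the origin that stay away from the zeros `node ε k`. -/
noncomputable def separatingRadius (ε N : ℕ) : ℝ := (N + (ε + 1) / 2) * π

theorem node_add_phase (ε : ℕ) (k : ℤ) : node ε k + phase ε = k * π := by
  rw [node, phase]
  ring

theorem node_injective (ε : ℕ) : Function.Injective (node ε) := fun k l h => by
  simpa [node, Real.pi_ne_zero] using h

theorem sin_add_phase_eq_zero_iff {ε : ℕ} {z : ℂ} :
    Complex.sin (z + phase ε) = 0 ↔ ∃ k : ℤ, z = node ε k := by
  rw [Complex.sin_eq_zero_iff]
  refine exists_congr fun k => ?_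
  rw [← eq_sub_iff_add_eq, eq_sub_of_add_eq (node_add_phase ε k)]
  push_cast
  rfl

theorem cos_node_add_phase (ε : ℕ) (k : ℤ) : Complex.cos (node ε k + phase ε) = (-1) ^ k := by
  rw [← Complex.ofReal_add, node_add_phase, ← Complex.ofReal_cos, Real.cos_int_mul_pi]
  push_cast
  rfl

theorem abs_node_lt_separatingRadius_iff {ε N : ℕ} {k : ℤ} :
    |node ε k| < separatingRadius ε N ↔ k ∈ Finset.Icc (-(N : ℤ)) (N + ε) := by
  rw [node, separatingRadius, abs_mul, abs_of_pos Real.pi_pos, mul_comm,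
    mul_lt_mul_iff_left₀ Real.pi_pos, abs_lt, Finset.mem_Icc]
  have hlower : -((N : ℝ) + (ε + 1) / 2) < k - ε / 2 ↔ -(2 * N + 1 : ℤ) < 2 * k := by
    rw [← Int.cast_lt (R := ℝ)]
    push_cast
    constructor <;> intro h <;> linarith
  have hupper : (k : ℝ) - ε / 2 < N + (ε + 1) / 2 ↔ 2 * k < (2 * N + 2 * ε + 1 : ℤ) := by
    rw [← Int.cast_lt (R := ℝ)]
    push_cast
    constructor <;> intro h <;> linarith
  rw [hlower, hupper]
  omega

theorem three_halves_le_separatingRadius (ε N : ℕ) : 3 / 2 ≤ separatingRadius ε N := by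
  have hN : (1 : ℝ) / 2 ≤ N + (ε + 1) / 2 := by
    linarith [(N.cast_nonneg : (0 : ℝ) ≤ N), (ε.cast_nonneg : (0 : ℝ) ≤ ε)]
  rw [separatingRadius]
  nlinarith [Real.pi_gt_three]

theorem separatingRadius_pos (ε N : ℕ) : 0 < separatingRadius ε N := by
  linarith [three_halves_le_separatingRadius ε N]

theorem tendsto_separatingRadius (ε : ℕ) : Tendsto (separatingRadius ε) atTop atTop :=
  (tendsto_atTop_add_const_right _ _ tendsto_natCast_atTop_atTop).atTop_mul_const Real.pi_pos

theorem abs_sin_add_phase (ε N : ℕ) (x : ℝ) :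
    |Real.sin (x + phase ε)| = |Real.cos (separatingRadius ε N - |x|)| := by
  rcases abs_choice x with hx | hx
  · have h : x + phase ε = (N + ε : ℕ) * π - (separatingRadius ε N - |x| - π / 2) := by
      rw [hx, phase, separatingRadius]
      push_cast
      ring
    rw [h, Real.sin_nat_mul_pi_sub, Real.sin_sub_pi_div_two]
    simp [abs_mul]
  · have h : x + phase ε = separatingRadius ε N - |x| - π / 2 - N * π := by
      rw [hx, phase, separatingRadius]
      ring
    rw [h, Real.sin_sub_nat_mul_pi, Real.sin_sub_pi_div_two]
    simp [abs_mul]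

theorem exp_abs_im_le_norm_sin_add_phase {ε N : ℕ} {z : ℂ} (hz : ‖z‖ = separatingRadius ε N) :
    Real.exp |z.im| ≤ 6 * ‖Complex.sin (z + phase ε)‖ := by
  refine exp_abs_le_of_sq_eq_add_sinh_sq (norm_nonneg _) (s := Real.sin (z.re + phase ε))
    (by simpa using norm_sin_sq (z + phase ε)) fun hy => ?_
  rw [abs_sin_add_phase ε N]
  refine (half_le_cos_sub_abs (three_halves_le_separatingRadius ε N) ?_ hy).trans (le_abs_self _)
  rw [← hz, Complex.sq_norm, Complex.normSq_apply]
  ring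

theorem sin_add_phase_ne_zero {ε N : ℕ} {z : ℂ} (hz : ‖z‖ = separatingRadius ε N) :
    Complex.sin (z + phase ε) ≠ 0 := fun hsin => by
  have h := exp_abs_im_le_norm_sin_add_phase hz
  rw [hsin, norm_zero, mul_zero] at h
  exact (Real.exp_pos _).not_ge h

end Kernel

section BoasLimit

/-- The function `z ↦ (sin (z + θ) - sinTaylor θ r z) / z ^ (r + 1)`, with the value at the origin
that makes it entire when `sin (θ + r * (π / 2)) = 0`. -/
noncomputable def sinQuotient (θ : ℝ) (r : ℕ) (z : ℂ) : ℂ :=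
  if z = 0 then (Real.sin (θ + (r + 1 : ℕ) * (π / 2)) / (r + 1)! : ℝ)
  else (Complex.sin (z + θ) - sinTaylor θ r z) / z ^ (r + 1)

theorem sinQuotient_of_ne_zero (θ : ℝ) (r : ℕ) {z : ℂ} (hz : z ≠ 0) :
    sinQuotient θ r z = (Complex.sin (z + θ) - sinTaylor θ r z) / z ^ (r + 1) :=
  if_neg hz

theorem norm_sinQuotient_sub_le {θ : ℝ} {r : ℕ} (hθ : Real.sin (θ + r * (π / 2)) = 0) (z : ℂ) :
    ‖sinQuotient θ r z - sinQuotient θ r 0‖ ≤ ‖z‖ * Real.exp ‖z‖ := by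
  rcases eq_or_ne z 0 with rfl | hz
  · simp
  have hrem : sinQuotient θ r z - sinQuotient θ r 0 =
      (Complex.sin (z + θ) - sinTaylor θ (r + 2) z) / z ^ (r + 1) := by
    rw [sinQuotient_of_ne_zero θ r hz, sinQuotient, if_pos rfl, sinTaylor_succ, sinTaylor_succ, hθ,
      zero_div, zero_smul, add_zero, Complex.real_smul]
    field_simp
    ring
  rw [hrem, norm_div, norm_pow, div_le_iff₀ (by positivity)]
  exact (norm_sin_add_sub_sinTaylor_le θ (r + 2) z).trans_eq (by ring)

theorem differentiable_sinQuotient {θ : ℝ} {r : ℕ} (hθ : Real.sin (θ + r * (π / 2)) = 0) :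
    Differentiable ℂ (sinQuotient θ r) := by
  have hcont : ContinuousAt (sinQuotient θ r) 0 := by
    refine tendsto_iff_norm_sub_tendsto_zero.2
      (squeeze_zero (fun _ => norm_nonneg _) (norm_sinQuotient_sub_le hθ) ?_)
    exact Continuous.tendsto' (by fun_prop) _ _ (by simp)
  have hoff : DifferentiableOn ℂ (sinQuotient θ r) {0}ᶜ := by
    have hsin := differentiable_sinTaylor θ r
    refine DifferentiableOn.congr
      (f := fun z => (Complex.sin (z + θ) - sinTaylor θ r z) / z ^ (r + 1)) ?_
      fun z hz => sinQuotient_of_ne_zero θ r hz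
    exact DifferentiableOn.div (by fun_prop) (by fun_prop) fun z hz => pow_ne_zero _ hz
  exact differentiableOn_univ.1 ((Complex.differentiableOn_compl_singleton_and_continuousAt_iff
    univ_mem).1 ⟨by rwa [← compl_eq_univ_sdiff], hcont⟩)

theorem sin_phase_add_eq_zero {ε r : ℕ} (hr : Even (ε + r)) :
    Real.sin (phase ε + r * (π / 2)) = 0 := by
  obtain ⟨m, hm⟩ := hr
  have hm' : (ε + r : ℝ) = m + m := mod_cast hm
  rw [phase, ← add_mul, hm', ← Real.sin_nat_mul_pi m]
  ring_nf

variable {E : Type*} [NormedAddCommGroup E] [NormedSpace ℂ E]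

theorem tendsto_circleIntegral_sinTaylor_div (ε r : ℕ) {G : ℂ → E} {M : ℝ}
    (hGM : ∀ z, ‖G z‖ ≤ M * Real.exp |z.im|) :
    Tendsto (fun N : ℕ => ∮ z in C(0, separatingRadius ε N),
      (sinTaylor (phase ε) r z / z ^ (r + 1) / Complex.sin (z + phase ε)) • G z) atTop (𝓝 0) := by
  have hM : 0 ≤ M := by simpa using (norm_nonneg _).trans (hGM 0)
  have hbound : ∀ N, ∀ z ∈ Metric.sphere (0 : ℂ) (separatingRadius ε N),
      ‖(sinTaylor (phase ε) r z / z ^ (r + 1) / Complex.sin (z + phase ε)) • G z‖ ≤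
        r / separatingRadius ε N ^ 2 * (6 * M) := by
    intro N z hz
    have hz : ‖z‖ = separatingRadius ε N := mem_sphere_zero_iff_norm.1 hz
    have hT := norm_sinTaylor_div_pow_le (phase ε) r (z := z)
      (by linarith [three_halves_le_separatingRadius ε N])
    have hS := exp_abs_im_le_norm_sin_add_phase hz
    have hSpos : 0 < ‖Complex.sin (z + phase ε)‖ := norm_pos_iff.2 (sin_add_phase_ne_zero hz)
    have hG : ‖Complex.sin (z + phase ε)‖⁻¹ * ‖G z‖ ≤ 6 * M := by
      rw [inv_mul_le_iff₀ hSpos]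
      nlinarith [hGM z]
    rw [norm_smul, norm_div _ (Complex.sin _), div_eq_mul_inv ‖_‖, mul_assoc]
    gcongr
    rwa [hz] at hT
  have hlim : Tendsto (fun N => 2 * π * (r * (6 * M)) * (separatingRadius ε N)⁻¹) atTop (𝓝 0) := by
    simpa using (tendsto_inv_atTop_zero.comp (tendsto_separatingRadius ε)).const_mul _
  refine squeeze_zero_norm (fun N => ?_) hlim
  have hR := separatingRadius_pos ε N
  refine (circleIntegral.norm_integral_le_of_norm_le_const hR.le (hbound N)).trans_eq ?_
  field_simp

variable [CompleteSpace E]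

theorem circleIntegral_sinQuotient_div {ε r : ℕ} (hr : Even (ε + r)) {G : ℂ → E}
    (hG : Differentiable ℂ G) (N : ℕ) :
    (∮ z in C(0, separatingRadius ε N),
      (sinQuotient (phase ε) r z / Complex.sin (z + phase ε)) • G z) =
    (2 * π * Complex.I) • ∑ k ∈ Finset.Icc (-(N : ℤ)) (N + ε),
      ((-1) ^ k * sinQuotient (phase ε) r (node ε k)) • G (node ε k) := by
  have hq := differentiable_sinQuotient (sin_phase_add_eq_zero hr)
  let toNode : ℤ ↪ ℂ := ⟨fun k => node ε k, Complex.ofReal_injective.comp (node_injective ε)⟩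
  have hmem : ∀ k, ‖toNode k‖ < separatingRadius ε N ↔ k ∈ Finset.Icc (-(N : ℤ)) (N + ε) :=
    fun k => by
      rw [← abs_node_lt_separatingRadius_iff, ← Real.norm_eq_abs, ← Complex.norm_real]
      rfl
  have hzero : ∀ z ∈ Metric.closedBall (0 : ℂ) (separatingRadius ε N),
      z ∉ (Finset.Icc (-(N : ℤ)) (N + ε)).map toNode → Complex.sin (z + phase ε) ≠ 0 := by
    intro z hz hzZ hsin
    obtain ⟨k, rfl⟩ := sin_add_phase_eq_zero_iff.1 hsin
    refine hzZ (Finset.mem_map_of_mem toNode ((hmem k).1 ?_))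
    exact (mem_closedBall_zero_iff.1 hz).lt_of_ne fun hk => sin_add_phase_ne_zero hk hsin
  rw [circleIntegral_eq_sum_of_hasSimpleResidueAt (separatingRadius_pos ε N).le
    (a := fun ζ => (sinQuotient (phase ε) r ζ / Complex.cos (ζ + phase ε)) • G ζ)
    (Z := (Finset.Icc (-(N : ℤ)) (N + ε)).map toNode)]
  · rw [Finset.sum_map]
    congr 1
    refine Finset.sum_congr rfl fun k _ => ?_
    change (sinQuotient _ r (node ε k) / Complex.cos (node ε k + phase ε)) • G (node ε k) = _
    rw [cos_node_add_phase, div_eq_inv_mul, ← inv_zpow, inv_neg_one]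
  · intro ζ hζ
    obtain ⟨k, hk, rfl⟩ := Finset.mem_map.1 (Finset.mem_coe.1 hζ)
    exact mem_ball_zero_iff.2 ((hmem k).2 hk)
  · intro z hz hzZ
    have hsin := hzero z hz hzZ
    have hqz : DifferentiableAt ℂ (sinQuotient (phase ε) r) z := hq z
    have hGz : DifferentiableAt ℂ G z := hG z
    fun_prop (disch := assumption)
  · intro ζ hζ
    obtain ⟨k, -, rfl⟩ := Finset.mem_map.1 hζ
    refine hasSimpleResidueAt_div_smul hq.continuous.continuousAt
      ((Complex.hasDerivAt_sin _).comp_add_const _ _)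
      (sin_add_phase_eq_zero_iff.2 ⟨k, rfl⟩) ?_ hG.continuous.continuousAt
    change Complex.cos (node ε k + phase ε) ≠ 0
    rw [cos_node_add_phase]
    exact zpow_ne_zero k (by norm_num)

theorem circleIntegral_sinTaylor_div {ε r : ℕ} (hr : Even (ε + r)) {G : ℂ → E}
    (hG : Differentiable ℂ G) (N : ℕ) :
    (∮ z in C(0, separatingRadius ε N),
      (sinTaylor (phase ε) r z / z ^ (r + 1) / Complex.sin (z + phase ε)) • G z) =
    (2 * π * Complex.I) • ((r ! : ℂ)⁻¹ • iteratedDeriv r G 0 -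
      ∑ k ∈ Finset.Icc (-(N : ℤ)) (N + ε),
        ((-1) ^ k * sinQuotient (phase ε) r (node ε k)) • G (node ε k)) := by
  have hq := differentiable_sinQuotient (sin_phase_add_eq_zero hr)
  have hR := separatingRadius_pos ε N
  have hne : ∀ z ∈ Metric.sphere (0 : ℂ) (separatingRadius ε N),
      z ≠ 0 ∧ Complex.sin (z + phase ε) ≠ 0 := fun z hz =>
    ⟨Metric.ne_of_mem_sphere hz hR.ne', sin_add_phase_ne_zero (mem_sphere_zero_iff_norm.1 hz)⟩
  have hsplit : ∀ z ∈ Metric.sphere (0 : ℂ) (separatingRadius ε N),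
      (sinTaylor (phase ε) r z / z ^ (r + 1) / Complex.sin (z + phase ε)) • G z =
        (1 / (z - 0) ^ (r + 1)) • G z -
          (sinQuotient (phase ε) r z / Complex.sin (z + phase ε)) • G z := by
    intro z hz
    obtain ⟨hz₀, hsin⟩ := hne z hz
    rw [← sub_smul, sinQuotient_of_ne_zero _ _ hz₀, sub_zero]
    congr 1
    field_simp
    ring
  have hpole : CircleIntegrable (fun z => (1 / (z - 0) ^ (r + 1)) • G z) 0 (separatingRadius ε N) :=
    ContinuousOn.circleIntegrable hR.le <| .smul
      (.div (by fun_prop) (by fun_prop) fun z hz => by simpa using (hne z hz).1)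
      hG.continuous.continuousOn
  have hquot : CircleIntegrable
      (fun z => (sinQuotient (phase ε) r z / Complex.sin (z + phase ε)) • G z) 0
      (separatingRadius ε N) :=
    ContinuousOn.circleIntegrable hR.le <| .smul
      (.div hq.continuous.continuousOn (by fun_prop) fun z hz => (hne z hz).2)
      hG.continuous.continuousOn
  rw [circleIntegral.integral_congr hR.le hsplit, circleIntegral.integral_sub hpole hquot,
    circleIntegral_sinQuotient_div hr hG, hG.diffContOnCl.circleIntegral_one_div_sub_center_pow_smul
      hR r, smul_sub, smul_smul, ← div_eq_mul_inv]

theorem tendsto_sum_sinQuotient {ε r : ℕ} (hr : Even (ε + r)) {G : ℂ → E}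
    (hG : Differentiable ℂ G) {M : ℝ} (hGM : ∀ z, ‖G z‖ ≤ M * Real.exp |z.im|) :
    Tendsto (fun N : ℕ => ∑ k ∈ Finset.Icc (-(N : ℤ)) (N + ε),
      ((-1) ^ k * sinQuotient (phase ε) r (node ε k)) • G (node ε k)) atTop
      (𝓝 ((r ! : ℂ)⁻¹ • iteratedDeriv r G 0)) := by
  have hlim := tendsto_circleIntegral_sinTaylor_div ε r hGM
  simp_rw [circleIntegral_sinTaylor_div hr hG] at hlim
  have hsub := (hlim.const_smul (2 * π * Complex.I)⁻¹).const_sub ((r ! : ℂ)⁻¹ • iteratedDeriv r G 0)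
  simpa only [inv_smul_smul₀ Complex.two_pi_I_ne_zero, sub_sub_cancel, smul_zero, sub_zero]
    using hsub

end BoasLimit

section Coefficients

/-- The common form of the Riesz–Boas coefficients: `A_{m,k}` is `boasCoeff 1 (2 * m - 1) k` and
`B_{m,k}` is `boasCoeff 0 (2 * m) k`. -/
noncomputable def boasCoeff (ε r : ℕ) (k : ℤ) : ℝ :=
  r ! * π ^ r *
    if node ε k = 0 then -(Real.sin (phase ε + (r + 1 : ℕ) * (π / 2)) / (r + 1)!)
    else sinTaylor (phase ε) r (node ε k) / node ε k ^ (r + 1)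

theorem ofReal_boasCoeff (ε r : ℕ) (k : ℤ) :
    (boasCoeff ε r k : ℂ) = -(r ! * π ^ r * sinQuotient (phase ε) r (node ε k)) := by
  rcases eq_or_ne (node ε k) 0 with hk | hk
  · simp [boasCoeff, sinQuotient, hk]
  · rw [boasCoeff, if_neg hk, sinQuotient_of_ne_zero _ _ (mod_cast hk),
      sin_add_phase_eq_zero_iff.2 ⟨k, rfl⟩, ← ofReal_sinTaylor]
    push_cast
    ring

theorem summable_boasCoeff (ε r : ℕ) : Summable (boasCoeff ε r) := by
  have hsq : Summable fun k : ℤ => r ! * π ^ r * (r / ‖node ε k‖ ^ 2) := by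
    have hint := (Real.summable_one_div_int_add_rpow (-ε / 2) 2).2 one_lt_two
    refine (hint.mul_left (r ! * π ^ r * (r / π ^ 2))).congr fun k => ?_
    rw [node, Real.norm_eq_abs, abs_mul, abs_of_pos Real.pi_pos, neg_div, ← sub_eq_add_neg]
    norm_cast
    field_simp
  have hlarge : ∀ᶠ k in cofinite, 1 ≤ ‖node ε k‖ := by
    filter_upwards [(Finset.Icc (-((0 : ℕ) : ℤ)) ((0 : ℕ) + ε)).finite_toSet.compl_mem_cofinite]
      with k hk
    have hk : separatingRadius ε 0 ≤ |node ε k| :=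
      not_lt.1 (mt abs_node_lt_separatingRadius_iff.1 hk)
    rw [Real.norm_eq_abs]
    linarith [three_halves_le_separatingRadius ε 0]
  refine .of_norm_bounded_eventually hsq (hlarge.mono fun k hk => ?_)
  have hk₀ : node ε k ≠ 0 := norm_pos_iff.1 (one_pos.trans_le hk)
  rw [boasCoeff, if_neg hk₀, norm_mul, Real.norm_of_nonneg (by positivity)]
  gcongr
  exact norm_sinTaylor_div_pow_le _ _ hk

theorem sin_phase_zero_add (m : ℕ) :
    Real.sin (phase 0 + (2 * m + 1 : ℕ) * (π / 2)) = (-1) ^ m := by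
  rw [← Real.cos_nat_mul_pi, ← Real.sin_add_pi_div_two, phase]
  push_cast
  ring_nf

theorem sin_phase_one_add (m : ℕ) : Real.sin (phase 1 + (2 * m : ℕ) * (π / 2)) = (-1) ^ m := by
  rw [← Real.cos_nat_mul_pi, ← Real.sin_add_pi_div_two, phase]
  push_cast
  ring_nf

theorem sinTaylor_phase_zero (m : ℕ) (x : ℝ) :
    sinTaylor (phase 0) (2 * m) x =
      ∑ j ∈ Finset.range m, (-1) ^ j * x ^ (2 * j + 1) / (2 * j + 1)! := by
  induction m with
  | zero => simp [sinTaylor]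
  | succ m ih =>
    rw [Finset.sum_range_succ, ← ih, mul_add_one, sinTaylor_succ, sinTaylor_succ,
      sin_phase_add_eq_zero (by simp), sin_phase_zero_add, smul_eq_mul, smul_eq_mul]
    ring

theorem sinTaylor_phase_one (m : ℕ) (x : ℝ) :
    sinTaylor (phase 1) (2 * m + 1) x =
      ∑ j ∈ Finset.range (m + 1), (-1) ^ j / (2 * j)! * x ^ (2 * j) := by
  induction m with
  | zero => simp [sinTaylor, phase]
  | succ m ih =>
    rw [Finset.sum_range_succ, ← ih, mul_add_one, sinTaylor_succ, sinTaylor_succ,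
      sin_phase_add_eq_zero (by simp [parity_simps]), ← mul_add_one, sin_phase_one_add, smul_eq_mul,
      smul_eq_mul]
    ring

theorem mellinB_eq_boasCoeff (m : ℕ) (k : ℤ) : Mellin.B m k = boasCoeff 0 (2 * m) k := by
  have hnode : node 0 k = π * k := by simp [node]
  rcases eq_or_ne k 0 with rfl | hk
  · rw [Mellin.B, if_pos rfl, boasCoeff, hnode, if_pos (by simp), sin_phase_zero_add,
      Nat.factorial_succ]
    push_cast
    field_simp
    ring
  · have hk' : (k : ℝ) ≠ 0 := mod_cast hk
    rw [Mellin.B, if_neg hk, boasCoeff, hnode, if_neg (mul_ne_zero Real.pi_ne_zero hk'),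
      sinTaylor_phase_zero]
    field_simp
    ring

theorem mellinA_succ_eq_boasCoeff (m : ℕ) (k : ℤ) :
    Mellin.A (m + 1) k = boasCoeff 1 (2 * m + 1) k := by
  have hnode : node 1 k = π * (k - 1 / 2) := by simp [node]
  have hk : (k - 1 / 2 : ℝ) ≠ 0 := sub_ne_zero.2 fun h => by
    have h2 : (2 * k : ℝ) = 1 := by linarith
    norm_cast at h2
    omega
  rw [Mellin.A, boasCoeff, hnode, if_neg (mul_ne_zero Real.pi_ne_zero hk), sinTaylor_phase_one,
    show 2 * (m + 1) - 1 = 2 * m + 1 by omega]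
  generalize (k : ℝ) - 1 / 2 = x at hk
  field_simp
  ring

end Coefficients

section EntireExtension

variable {E : Type*} [NormedAddCommGroup E] [NormedSpace ℂ E]

theorem eq_of_differentiable_of_eq_ofReal [CompleteSpace E] {F G : ℂ → E}
    (hF : Differentiable ℂ F) (hG : Differentiable ℂ G) (h : ∀ t : ℝ, F t = G t) : F = G := by
  have hlim : Tendsto (fun t : ℝ => (t : ℂ)) (𝓝[≠] 0) (𝓝[≠] 0) := by
    refine tendsto_nhdsWithin_iff.2 ⟨(Complex.continuous_ofReal.tendsto' 0 0 rfl).mono_left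
      nhdsWithin_le_nhds, ?_⟩
    filter_upwards [self_mem_nhdsWithin] with t ht using Complex.ofReal_ne_zero.2 ht
  exact AnalyticOnNhd.eq_of_frequently_eq (fun z _ => hF.analyticAt z) (fun z _ => hG.analyticAt z)
    (hlim.frequently (Eventually.of_forall h).frequently)

theorem iteratedDeriv_comp_ofReal [CompleteSpace E] {G : ℂ → E} (hG : Differentiable ℂ G) (n : ℕ) :
    iteratedDeriv n (fun t : ℝ => G t) = fun t : ℝ => iteratedDeriv n G t := by
  induction n with
  | zero => simp
  | succ n ih =>
    funext t
    have hd : DifferentiableAt ℂ (iteratedDeriv n G) t :=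
      (hG.contDiff (n := n + 1)).differentiable_iteratedDeriv n (mod_cast n.lt_succ_self) t
    rw [iteratedDeriv_succ, ih, iteratedDeriv_succ]
    simpa [Function.comp_def] using (hd.hasDerivAt.scomp t Complex.ofRealCLM.hasDerivAt).deriv

/-- The exponential generating function `z ↦ ∑ a_n z ^ n / n!` of a sequence of vectors, that is,
the power series with `n`-th derivative `a n` at the origin. -/
noncomputable def expSeries (a : ℕ → E) (z : ℂ) : E := ∑' n, (z ^ n / n !) • a n

theorem norm_expSeries_term_le {a : ℕ → E} {σ M : ℝ} (ha : ∀ n, ‖a n‖ ≤ σ ^ n * M) (z : ℂ)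
    (n : ℕ) : ‖(z ^ n / n ! : ℂ) • a n‖ ≤ (σ * ‖z‖) ^ n / n ! * M := by
  rw [norm_smul, norm_div, norm_pow, Complex.norm_natCast]
  refine (mul_le_mul_of_nonneg_left (ha n) (by positivity)).trans_eq ?_
  ring

theorem norm_expSeries_le {a : ℕ → E} {σ M : ℝ} (ha : ∀ n, ‖a n‖ ≤ σ ^ n * M) (z : ℂ) :
    ‖expSeries a z‖ ≤ M * Real.exp (σ * ‖z‖) := by
  rw [mul_comm, Real.exp_eq_exp_ℝ]
  exact tsum_of_norm_bounded ((NormedSpace.expSeries_div_hasSum_exp (σ * ‖z‖)).mul_right M)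
    (norm_expSeries_term_le ha z)

theorem hasSum_expSeries [CompleteSpace E] {a : ℕ → E} {σ M : ℝ}
    (ha : ∀ n, ‖a n‖ ≤ σ ^ n * M) (z : ℂ) :
    HasSum (fun n => (z ^ n / n ! : ℂ) • a n) (expSeries a z) :=
  (Summable.of_norm_bounded ((Real.summable_pow_div_factorial (σ * ‖z‖)).mul_right M)
    (norm_expSeries_term_le ha z)).hasSum

theorem differentiable_expSeries [CompleteSpace E] {a : ℕ → E} {σ M : ℝ}
    (hσ : 0 ≤ σ) (ha : ∀ n, ‖a n‖ ≤ σ ^ n * M) : Differentiable ℂ (expSeries a) := by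
  intro z
  have hM : 0 ≤ M := by simpa using (norm_nonneg _).trans (ha 0)
  refine DifferentiableOn.differentiableAt (s := Metric.ball 0 (‖z‖ + 1)) ?_
    (Metric.isOpen_ball.mem_nhds (by simp))
  refine Complex.differentiableOn_tsum_of_summable_norm
    ((Real.summable_pow_div_factorial (σ * (‖z‖ + 1))).mul_right M)
    (fun n => by fun_prop) Metric.isOpen_ball fun n w hw => ?_
  refine (norm_expSeries_term_le ha w n).trans ?_
  gcongr
  exact (mem_ball_zero_iff.1 hw).le

/-- The smooth curves all of whose derivatives obey a Bernstein bound, `‖f⁽ⁿ⁾‖ ≤ σ ^ n * M`. -/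
structure IsBernsteinCurve (σ M : ℝ) (f : ℝ → E) : Prop where
  contDiff : ContDiff ℝ (⊤ : ℕ∞) f
  norm_iteratedDeriv_le : ∀ n t, ‖iteratedDeriv n f t‖ ≤ σ ^ n * M

namespace IsBernsteinCurve

variable {σ M : ℝ} {f : ℝ → E}

theorem deriv (hf : IsBernsteinCurve σ M f) : IsBernsteinCurve σ (σ * M) (deriv f) where
  contDiff := (contDiff_infty_iff_deriv.1 hf.contDiff).2
  norm_iteratedDeriv_le n t := by
    rw [← iteratedDeriv_succ', ← mul_assoc, ← pow_succ]
    exact hf.norm_iteratedDeriv_le (n + 1) t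

variable [CompleteSpace E]

theorem norm_sub_taylor_le (hf : IsBernsteinCurve σ M f) (x t : ℝ) (n : ℕ) :
    ‖f (x + t) - ∑ k ∈ Finset.range (n + 1), (t ^ k / k ! : ℂ) • iteratedDeriv k f x‖ ≤
      σ * |t| * M * ((σ * |t|) ^ n / n !) := by
  have hderiv : ∀ (k : ℕ) (s : ℝ),
      iteratedFDeriv ℝ k f s (fun _ => t) = t ^ k • iteratedDeriv k f s :=
    fun k s => by simp [iteratedFDeriv_apply_eq_iteratedDeriv_mul_prod]
  have htaylor := map_add_eq_sum_add_integral_iteratedFDeriv (f := f) (x := x) (y := t) (n := n)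
    fun s _ => hf.contDiff.contDiffAt.of_le (mod_cast le_top)
  have hterm : ∀ k : ℕ, (t ^ k / k ! : ℂ) • iteratedDeriv k f x =
      (k ! : ℝ)⁻¹ • t ^ k • iteratedDeriv k f x := fun k => by
    rw [smul_smul, ← Complex.coe_smul, div_eq_inv_mul]
    push_cast
    rfl
  have hrem : ‖∫ s in (0 : ℝ)..1, (1 - s) ^ n • t ^ (n + 1) • iteratedDeriv (n + 1) f (x + s • t)‖ ≤
      (σ * |t|) ^ (n + 1) * M * |1 - 0| := by
    refine intervalIntegral.norm_integral_le_of_norm_le_const fun s hs => ?_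
    rw [uIoc_of_le zero_le_one] at hs
    rw [norm_smul, norm_smul, norm_pow, norm_pow, Real.norm_of_nonneg (sub_nonneg.2 hs.2)]
    refine (mul_le_of_le_one_left (by positivity)
      (pow_le_one₀ (sub_nonneg.2 hs.2) (by linarith [hs.1]))).trans ?_
    refine (mul_le_mul_of_nonneg_left (hf.norm_iteratedDeriv_le _ _) (by positivity)).trans_eq ?_
    rw [Real.norm_eq_abs]
    ring
  simp_rw [hderiv] at htaylor
  simp_rw [hterm]
  rw [htaylor, add_sub_cancel_left, norm_smul, norm_inv, Real.norm_natCast]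
  refine (mul_le_mul_of_nonneg_left hrem (by positivity)).trans_eq ?_
  rw [sub_zero, abs_one]
  ring

theorem apply_add (hf : IsBernsteinCurve σ M f) (x t : ℝ) :
    f (x + t) = expSeries (fun n => iteratedDeriv n f x) t := by
  have hsum := (hasSum_expSeries (hf.norm_iteratedDeriv_le · x) (t : ℂ)).tendsto_sum_nat
  refine tendsto_nhds_unique ?_ (hsum.comp (tendsto_add_atTop_nat 1))
  refine tendsto_iff_norm_sub_tendsto_zero.2 (squeeze_zero (fun _ => norm_nonneg _)
    (fun n => (norm_sub_rev _ _).trans_le (hf.norm_sub_taylor_le x t n)) ?_)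
  simpa using (FloorSemiring.tendsto_pow_div_factorial_atTop (σ * |t|)).const_mul (σ * |t| * M)

theorem exists_entire_extension (hσ : 0 ≤ σ) (hf : IsBernsteinCurve σ M f) :
    ∃ G : ℂ → E, Differentiable ℂ G ∧ (∀ t : ℝ, G t = f t) ∧
      ∀ z, ‖G z‖ ≤ M * Real.exp (σ * |z.im|) := by
  have hdiff := fun x => differentiable_expSeries hσ (hf.norm_iteratedDeriv_le · x)
  refine ⟨_, hdiff 0, fun t => by rw [← hf.apply_add, zero_add], fun z => ?_⟩
  have hrecenter : expSeries (fun n => iteratedDeriv n f 0) =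
      fun w => expSeries (fun n => iteratedDeriv n f z.re) (w - z.re) := by
    refine eq_of_differentiable_of_eq_ofReal (hdiff 0)
      ((hdiff z.re).comp (differentiable_id.sub_const _)) fun t => ?_
    rw [← hf.apply_add, ← Complex.ofReal_sub, ← hf.apply_add, zero_add, add_sub_cancel]
  have him : ‖z - z.re‖ = |z.im| := by
    rw [sub_eq_of_eq_add' (Complex.re_add_im z).symm]
    simp
  rw [hrecenter, ← him]
  exact norm_expSeries_le (hf.norm_iteratedDeriv_le · z.re) _

end IsBernsteinCurve

end EntireExtension

section BoasFormula

variable {E : Type*} [NormedAddCommGroup E] [NormedSpace ℂ E]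

theorem tendsto_Icc_neg_natCast_atTop (ε : ℕ) :
    Tendsto (fun N : ℕ => Finset.Icc (-(N : ℤ)) (N + ε)) atTop atTop := by
  refine tendsto_atTop_finset_of_monotone (fun M N h => ?_) fun k => ⟨k.natAbs, ?_⟩
  · exact Finset.Icc_subset_Icc (by omega) (by omega)
  · rw [Finset.mem_Icc]
    omega

theorem norm_boasCoeff_smul (ε r : ℕ) (k : ℤ) (v : E) :
    ‖((-1) ^ (k + 1) * boasCoeff ε r k) • v‖ = |boasCoeff ε r k| * ‖v‖ := by
  rw [norm_smul, norm_mul, norm_zpow, norm_neg, norm_one, one_zpow, one_mul, Real.norm_eq_abs]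

variable [CompleteSpace E]

theorem summable_boasCoeff_smul (ε r : ℕ) {M : ℝ} {v : ℤ → E} (hv : ∀ k, ‖v k‖ ≤ M) :
    Summable fun k => ((-1) ^ (k + 1) * boasCoeff ε r k) • v k := by
  refine Summable.of_norm_bounded ((summable_boasCoeff ε r).abs.mul_right M) fun k => ?_
  rw [norm_boasCoeff_smul]
  exact mul_le_mul_of_nonneg_left (hv k) (abs_nonneg _)

theorem hasSum_boasCoeff_smul_entire {ε r : ℕ} (hr : Even (ε + r)) {G : ℂ → E} {M : ℝ}
    (hG : Differentiable ℂ G) (hGM : ∀ z, ‖G z‖ ≤ M * Real.exp |z.im|) :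
    HasSum (fun k => ((-1) ^ (k + 1) * boasCoeff ε r k) • G (node ε k))
      (π ^ r • iteratedDeriv r G 0) := by
  have hsum := (summable_boasCoeff_smul ε r (v := fun k => G (node ε k)) (M := M)
    fun k => (hGM _).trans_eq (by simp)).hasSum
  convert hsum using 1
  have hlim := (tendsto_sum_sinQuotient hr hG hGM).const_smul ((r ! : ℂ) * (π : ℂ) ^ r)
  rw [smul_smul, mul_right_comm, mul_inv_cancel₀ (mod_cast r.factorial_ne_zero), one_mul] at hlim
  rw [← Complex.coe_smul, Complex.ofReal_pow]
  refine tendsto_nhds_unique hlim ((hsum.comp (tendsto_Icc_neg_natCast_atTop ε)).congr fun N => ?_)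
  rw [Finset.smul_sum]
  refine Finset.sum_congr rfl fun k _ => ?_
  beta_reduce
  rw [smul_smul, ← Complex.coe_smul, Complex.ofReal_mul, ofReal_boasCoeff, zpow_add_one₀ (by simp)]
  push_cast
  ring_nf

theorem boasCoeff_one_one (k : ℤ) : boasCoeff 1 1 k = 1 / (π * (k - 1 / 2) ^ 2) := by
  simpa [Mellin.A] using (mellinA_succ_eq_boasCoeff 0 k).symm

theorem hasSum_abs_boasCoeff_one_one : HasSum (fun k => |boasCoeff 1 1 k|) π := by
  -- Boas' formula for the extremal function `exp (i (z + π / 2))`, all of whose terms have the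
  -- same sign.
  have hphase : (phase 1 : ℂ) = π / 2 := by simp [phase]
  have hderiv : iteratedDeriv 1 (fun z => Complex.exp ((z + phase 1) * Complex.I)) 0 = -1 := by
    simp [hphase, Complex.exp_pi_div_two_mul_I]
  have hnode (k : ℤ) : Complex.exp ((node 1 k + phase 1) * Complex.I) = ((-1) ^ k : ℝ) := by
    rw [Complex.exp_mul_I, cos_node_add_phase, sin_add_phase_eq_zero_iff.2 ⟨k, rfl⟩]
    push_cast
    ring
  have hbound (z : ℂ) : ‖Complex.exp ((z + phase 1) * Complex.I)‖ ≤ 1 * Real.exp |z.im| := by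
    rw [Complex.norm_exp, one_mul]
    simp [neg_le_abs]
  have hsum := hasSum_boasCoeff_smul_entire (r := 1) even_two (by fun_prop) hbound
  rw [hderiv] at hsum
  simp_rw [hnode] at hsum
  have hterm (k : ℤ) : ((|boasCoeff 1 1 k| : ℝ) : ℂ) =
      -(((-1) ^ (k + 1) * boasCoeff 1 1 k) • (((-1) ^ k : ℝ) : ℂ)) := by
    have hsign : ((-1) ^ (k + 1) * (-1) ^ k : ℝ) = -1 := by
      rw [zpow_add_one₀ (by simp), mul_right_comm, ← mul_zpow]
      simp
    rw [abs_of_nonneg (by rw [boasCoeff_one_one]; positivity), ← Complex.coe_smul, smul_eq_mul,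
      ← Complex.ofReal_mul, mul_right_comm, hsign, neg_one_mul, Complex.ofReal_neg, neg_neg]
  have hpi : (π : ℂ) = -(π ^ 1 • (-1 : ℂ)) := by simp
  rw [← Complex.hasSum_ofReal, hpi]
  simp_rw [hterm]
  exact hsum.neg

namespace IsBernsteinCurve

variable {σ M : ℝ} {f : ℝ → E}

theorem hasSum_boasCoeff_smul (hσ : 0 < σ) (hf : IsBernsteinCurve σ M f) {ε r : ℕ}
    (hr : Even (ε + r)) (t : ℝ) :
    HasSum (fun k => ((-1) ^ (k + 1) * boasCoeff ε r k) • f (t + node ε k / σ))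
      ((π / σ) ^ r • iteratedDeriv r f t) := by
  obtain ⟨G, hG, hGf, hGM⟩ := hf.exists_entire_extension hσ.le
  have hmaps : ∀ s : ℝ, G (t + (σ : ℂ)⁻¹ * s) = f (t + s / σ) := fun s => by
    rw [← hGf, div_eq_inv_mul]
    push_cast
    rfl
  have hsum := hasSum_boasCoeff_smul_entire hr (G := fun z => G (t + (σ : ℂ)⁻¹ * z)) (M := M)
    (hG.comp (by fun_prop)) fun z => (hGM _).trans_eq (by
      rw [← Complex.ofReal_inv, Complex.add_im, Complex.ofReal_im, zero_add, Complex.im_ofReal_mul,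
        abs_mul, abs_of_pos (inv_pos.2 hσ), mul_inv_cancel_left₀ hσ.ne'])
  have hderiv : iteratedDeriv r (fun z => G (t + (σ : ℂ)⁻¹ * z)) 0 =
      σ⁻¹ ^ r • iteratedDeriv r f t := by
    have hscale := congr_fun (iteratedDeriv_comp_const_smul (n := r) (f := fun z => G (t + z))
      (hG.comp (by fun_prop)).contDiff (σ⁻¹ : ℂ)) 0
    have hreal := congr_fun (iteratedDeriv_comp_ofReal hG r) t
    simp only [iteratedDeriv_comp_const_add, mul_zero, add_zero, ← hreal, hGf] at hscale
    rw [hscale, ← Complex.ofReal_inv, ← Complex.ofReal_pow, Complex.coe_smul]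
  rw [hderiv, smul_smul, ← mul_pow, ← div_eq_mul_inv] at hsum
  simpa only [hmaps] using hsum

theorem norm_deriv_le (hσ : 0 < σ) (hf : IsBernsteinCurve σ M f) {B : ℝ}
    (hB : ∀ t, ‖f t‖ ≤ B) (t : ℝ) : ‖_root_.deriv f t‖ ≤ σ * B := by
  have hsum := hf.hasSum_boasCoeff_smul hσ (ε := 1) (r := 1) even_two t
  have hle : ‖(π / σ) ^ 1 • iteratedDeriv 1 f t‖ ≤ π * B := by
    rw [← hsum.tsum_eq]
    refine tsum_of_norm_bounded (hasSum_abs_boasCoeff_one_one.mul_right B) fun k => ?_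
    rw [norm_boasCoeff_smul]
    exact mul_le_mul_of_nonneg_left (hB _) (abs_nonneg _)
  rw [pow_one, iteratedDeriv_one, norm_smul, Real.norm_of_nonneg (by positivity),
    div_mul_eq_mul_div, mul_div_assoc] at hle
  rw [mul_comm]
  exact (div_le_iff₀ hσ).1 (le_of_mul_le_mul_left hle Real.pi_pos)

theorem of_norm_le (hσ : 0 < σ) (hf : IsBernsteinCurve σ M f) {B : ℝ}
    (hB : ∀ t, ‖f t‖ ≤ B) : IsBernsteinCurve σ B f where
  contDiff := hf.contDiff
  norm_iteratedDeriv_le n := by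
    induction n generalizing f M B with
    | zero => simpa using hB
    | succ n ih =>
      intro t
      rw [iteratedDeriv_succ', pow_succ, mul_assoc]
      exact ih hf.deriv (hf.norm_deriv_le hσ hB) t

end IsBernsteinCurve

end BoasFormula

/-- The one-parameter groups of isometries; no strong continuity is imposed. -/
structure IsometryGroup {E : Type*} [NormedAddCommGroup E] [NormedSpace ℂ E]
    (U : ℝ → E →ₗᵢ[ℂ] E) : Prop where
  map_add : ∀ s t, U (s + t) = (U s).comp (U t)

namespace IsometryGroup

variable {E : Type*} [NormedAddCommGroup E] [NormedSpace ℂ E] (U : ℝ → E →ₗᵢ[ℂ] E)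

/-- The infinitesimal generator `Θ f = d/dt U(t) f |_{t = 0}` of a group `U` of isometries. It is
defined on all of `E`, with value `0` where the derivative does not exist. -/
noncomputable def generator (f : E) : E := deriv (fun t => U t f) 0

/-- The domain of the `k`-th power of the generator. -/
def powDomain : ℕ → Set E
  | 0 => univ
  | k + 1 => {f | DifferentiableAt ℝ (fun t => U t f) 0 ∧ generator U f ∈ powDomain k}

/-- The Bernstein space `B_σ` of the generator: the vectors of exponential type at most `σ`. -/
def bernstein (σ : ℝ) : Set E :=
  {f | (∀ k, f ∈ powDomain U k) ∧ ∀ k, ‖(generator U)^[k] f‖ ≤ σ ^ k * ‖f‖}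

/-- The terms of the series defining the Riesz–Boas operator of order `r`. Odd orders use the
half-integer multiples of `π / σ` and even orders the integer ones. -/
noncomputable def rieszBoasTerm (r : ℕ) (σ : ℝ) (f : E) (k : ℤ) : E :=
  ((-1) ^ (k + 1) * boasCoeff (r % 2) r k) • U (node (r % 2) k / σ) f

/-- The Riesz–Boas operator `ℛ^(r)(σ)` of a group of isometries. -/
noncomputable def rieszBoas (r : ℕ) (σ : ℝ) (f : E) : E :=
  (σ / π) ^ r • ∑' k, rieszBoasTerm U r σ f k

variable {U} {σ : ℝ} {f : E}

theorem summable_rieszBoasTerm [CompleteSpace E] (r : ℕ) (σ : ℝ) (f : E) :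
    Summable (rieszBoasTerm U r σ f) :=
  summable_boasCoeff_smul _ r fun _ => ((U _).norm_map f).le

theorem apply_zero (hU : IsometryGroup U) (f : E) : U 0 f = f := by
  refine (U 0).injective ?_
  simpa using (DFunLike.congr_fun (hU.map_add 0 0) f).symm

theorem hasDerivAt_orbit (hU : IsometryGroup U) (hf : DifferentiableAt ℝ (fun t => U t f) 0)
    (t : ℝ) :
    HasDerivAt (fun s => U s f) (U t (generator U f)) t := by
  have hzero : HasDerivAt (fun s => U s f) (generator U f) (t - t) := by
    rw [sub_self]
    exact hf.hasDerivAt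
  have hshift := hzero.comp_sub_const t t
  have hcomp := ((U t).toContinuousLinearMap.restrictScalars ℝ).hasFDerivAt.comp_hasDerivAt t hshift
  refine hcomp.congr_of_eventuallyEq (Eventually.of_forall fun s => ?_)
  simpa using DFunLike.congr_fun (hU.map_add t (s - t)) f

theorem iteratedDeriv_orbit (hU : IsometryGroup U) (hf : ∀ k, f ∈ powDomain U k) (n : ℕ) :
    iteratedDeriv n (fun t => U t f) = fun t => U t ((generator U)^[n] f) := by
  induction n generalizing f with
  | zero => simp
  | succ n ih =>
    rw [iteratedDeriv_succ', funext fun t => (hU.hasDerivAt_orbit (hf 1).1 t).deriv]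
    exact ih fun k => (hf (k + 1)).2

theorem iterate_generator_mem_powDomain (hf : ∀ k, f ∈ powDomain U k) (n k : ℕ) :
    (generator U)^[n] f ∈ powDomain U k := by
  induction n generalizing f with
  | zero => exact hf k
  | succ _ ih => exact ih fun k => (hf (k + 1)).2

theorem isBernsteinCurve_orbit (hU : IsometryGroup U) (hf : f ∈ bernstein U σ) :
    IsBernsteinCurve σ ‖f‖ fun t => U t f where
  contDiff := contDiff_of_differentiable_iteratedDeriv fun n _ => by
    rw [hU.iteratedDeriv_orbit hf.1]
    exact fun t => (hU.hasDerivAt_orbit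
      (iterate_generator_mem_powDomain hf.1 n 1).1 t).differentiableAt
  norm_iteratedDeriv_le n t := by
    rw [hU.iteratedDeriv_orbit hf.1, LinearIsometry.norm_map]
    exact hf.2 n

variable [CompleteSpace E]

theorem iterate_generator_eq_rieszBoas (hU : IsometryGroup U) (hσ : 0 < σ)
    (hf : f ∈ bernstein U σ) (r : ℕ) : (generator U)^[r] f = rieszBoas U r σ f := by
  have hsum : HasSum (rieszBoasTerm U r σ f) ((π / σ) ^ r • (generator U)^[r] f) := by
    unfold rieszBoasTerm
    simpa only [hU.iteratedDeriv_orbit hf.1, hU.apply_zero, zero_add] using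
      (hU.isBernsteinCurve_orbit hf).hasSum_boasCoeff_smul hσ (ε := r % 2) (r := r)
        (Nat.even_iff.2 (by omega)) 0
  rw [rieszBoas, hsum.tsum_eq, smul_smul, ← mul_pow, div_mul_div_cancel₀ Real.pi_ne_zero,
    div_self hσ.ne', one_pow, one_smul]

theorem generator_mem_bernstein (hU : IsometryGroup U) (hσ : 0 < σ) (hf : f ∈ bernstein U σ) :
    generator U f ∈ bernstein U σ := by
  have hdom : ∀ k, generator U f ∈ powDomain U k := fun k => (hf.1 (k + 1)).2
  have hcurve : IsBernsteinCurve σ (σ * ‖f‖) fun t => U t (generator U f) := by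
    simpa [funext fun t => (hU.hasDerivAt_orbit (hf.1 1).1 t).deriv]
      using (hU.isBernsteinCurve_orbit hf).deriv
  have hbound := hcurve.of_norm_le hσ fun t => ((U t).norm_map _).le
  refine ⟨hdom, fun k => ?_⟩
  simpa [hU.iteratedDeriv_orbit hdom] using hbound.norm_iteratedDeriv_le k 0

theorem iterate_generator_eq_iterate_rieszBoas (hU : IsometryGroup U) (hσ : 0 < σ)
    (hf : f ∈ bernstein U σ) (r : ℕ) :
    (generator U)^[r] f = (rieszBoas U 1 σ)^[r] f := by
  induction r generalizing f with
  | zero => rfl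
  | succ r ih =>
    rw [Function.iterate_succ_apply, Function.iterate_succ_apply,
      ← hU.iterate_generator_eq_rieszBoas hσ hf 1]
    exact ih (hU.generator_mem_bernstein hσ hf)

end IsometryGroup

namespace Mellin

variable (p : ℝ≥0∞) [Fact (1 ≤ p)]

theorem isometryGroup_U : IsometryGroup (U p) where
  map_add s t := by
    refine LinearIsometry.ext fun f => Eq.trans ?_ (Lp.compMeasurePreserving_comp_apply f
      (measurePreserving_dilation t) (measurePreserving_dilation s))
    change Lp.compMeasurePreserving _ _ f = _
    congr 2
    funext x
    rw [Function.comp_apply, ← mul_assoc, ← Real.exp_add, add_comm]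

theorem rieszBoasTerm_eq_rieszBoasTerm_U (r : ℕ) (σ : ℝ) (f : X p) :
    rieszBoasTerm p r σ f = IsometryGroup.rieszBoasTerm (U p) r σ f := by
  funext k
  rw [rieszBoasTerm, IsometryGroup.rieszBoasTerm]
  rcases Nat.even_or_odd' r with ⟨m, rfl | rfl⟩
  · rw [if_pos (even_two_mul m), mellinB_eq_boasCoeff, Nat.mul_div_cancel_left _ two_pos,
      Nat.mul_mod_right, node, Nat.cast_zero, zero_div, sub_zero]
    rfl
  · rw [if_neg (Nat.not_even_two_mul_add_one m), show (2 * m + 1 + 1) / 2 = m + 1 by omega,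
      show (2 * m + 1) % 2 = 1 by omega, mellinA_succ_eq_boasCoeff, node, Nat.cast_one,
      div_mul_eq_mul_div]
    rfl

theorem rieszBoas_eq_rieszBoas_U (r : ℕ) (σ : ℝ) :
    rieszBoas p r σ = IsometryGroup.rieszBoas (U p) r σ := by
  funext f
  rw [rieszBoas, IsometryGroup.rieszBoas, rieszBoasTerm_eq_rieszBoasTerm_U]
  rfl

theorem theta_eq_generator_U : Theta p = IsometryGroup.generator (U p) :=
  rfl

theorem powDomain_eq_powDomain_U (k : ℕ) : powDomain p k = IsometryGroup.powDomain (U p) k := by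
  induction k with
  | zero => rfl
  | succ k ih =>
    rw [powDomain, ih, theta_eq_generator_U]
    rfl

theorem bernstein_eq_bernstein_U (σ : ℝ) : Bernstein p σ = IsometryGroup.bernstein (U p) σ := by
  simp only [Bernstein, powDomain_eq_powDomain_U, theta_eq_generator_U]
  rfl

end Mellin

open IsometryGroup in
theorem mainTheorem10_general {E : Type*} [NormedAddCommGroup E] [NormedSpace ℂ E]
    [CompleteSpace E] {U : ℝ → E →ₗᵢ[ℂ] E} (hU : IsometryGroup U) {σ : ℝ} (hσ : 0 < σ) :
    (∀ (r : ℕ) (g : E), Summable (rieszBoasTerm U r σ g)) ∧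
    (∀ f ∈ bernstein U σ, rieszBoas U 1 σ f ∈ bernstein U σ ∧
      generator U (rieszBoas U 1 σ f) = rieszBoas U 1 σ (generator U f)) ∧
    (∀ f ∈ bernstein U σ, ∀ r : ℕ, (generator U)^[r] f = rieszBoas U r σ f ∧
      rieszBoas U r σ f = (rieszBoas U 1 σ)^[r] f) := by
  have hone {f} (hf : f ∈ bernstein U σ) : generator U f = rieszBoas U 1 σ f :=
    hU.iterate_generator_eq_rieszBoas hσ hf 1
  refine ⟨fun r => summable_rieszBoasTerm r σ, fun f hf => ?_, fun f hf r => ?_⟩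
  · have hgen := hU.generator_mem_bernstein hσ hf
    rw [← hone hf, ← hone hgen]
    exact ⟨hgen, rfl⟩
  · have hr := hU.iterate_generator_eq_rieszBoas hσ hf r
    exact ⟨hr, hr.symm.trans (hU.iterate_generator_eq_iterate_rieszBoas hσ hf r)⟩

theorem mainTheorem10 (p : ℝ≥0∞) [Fact (1 ≤ p)] (hp₁ : 1 < p) (hp : p < ∞)
    (σ : ℝ) (hσ : 0 < σ) :
    (∀ r : ℕ, 1 ≤ r → ∀ g : Mellin.X p, Summable (Mellin.rieszBoasTerm p r σ g)) ∧
    (∀ f ∈ Mellin.Bernstein p σ,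
      Mellin.rieszBoas p 1 σ f ∈ Mellin.Bernstein p σ ∧
      Mellin.Theta p (Mellin.rieszBoas p 1 σ f) = Mellin.rieszBoas p 1 σ (Mellin.Theta p f)) ∧
    (∀ f ∈ Mellin.Bernstein p σ, ∀ r : ℕ, 1 ≤ r →
      (Mellin.Theta p)^[r] f = Mellin.rieszBoas p r σ f ∧
      Mellin.rieszBoas p r σ f = (Mellin.rieszBoas p 1 σ)^[r] f) := by
  obtain ⟨hsummable, hcommute, hiterate⟩ := mainTheorem10_general (Mellin.isometryGroup_U p) hσ
  simp only [funext (Mellin.rieszBoasTerm_eq_rieszBoasTerm_U p _ σ),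
    Mellin.rieszBoas_eq_rieszBoas_U, Mellin.bernstein_eq_bernstein_U, Mellin.theta_eq_generator_U]
  exact ⟨fun r _ => hsummable r, hcommute, fun f hf r _ => hiterate f hf r⟩
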